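/- Let $k$ be an algebraically closed field of characteristic zero. A (non-symmetric) binary quadratic operad $\mathcal P=\mathcal P(\Omega,\Lambda)$ is given by a finite-dimensional $k$-vector space $\Omega$ of binary operations and a subspace $\Lambda\subset\Omega^{\otimes 2}\oplus\Omega^{\otimes 2}$ of relations, where a pair $\left(\sum f_{ab}\,a\otimes b,\ \sum g_{ab}\,a\otimes b\right)$ stands for the relation $\sum f_{ab}\,(x\mathbin{a}y)\mathbin{b}z=\sum g_{ab}\,x\mathbin{a}(y\mathbin{b}z)$; $\mathcal P$ is the quotient of the free non-symmetric operad on $\Omega$ by the operadic ideal generated by these relations, and $\mathcal P(n)$ is its component of arity $n$. The black square product is $\mathcal P\,\blacksquare\,\mathcal Q=\mathcal P(\Omega_{\mathcal P}\otimes\Omega_{\mathcal Q},\Lambda)$, where $\Lambda$ is spanned by the pairs $(S_{23}(f\otimes f'),S_{23}(g\otimes g'))$ with $(f,g)\in\Lambda_{\mathcal P}$, $(f',g')\in\Lambda_{\mathcal Q}$, and $S_{23}$ switches the two middle tensor factors. The quadratic dual is $\mathcal P^!=\mathcal P(\Omega^{\vee},\Lambda^{\perp})$, with $\Omega^\vee$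 the linear dual of $\Omega$ and $\perp$ taken with respect to the pairing $\langle (f,g),(f',g')\rangle=\langle f,f'\rangle-\langle g,g'\rangle$. Let $\mathcal Dend$ be the operad with two operations $\prec,\succ$ and, with $*=\prec+\succ$, the three relations $$(x\prec y)\prec z=x\prec(y* z),\qquad (x\succ y)\prec z=x\succ(y\prec z),\qquad (x* y)\succ z=x\succ(y\succ z).$$ Then for every $m\ge 1$ and every $n$, the quadratic dual of the $m$-fold black square product $\mathcal Dend^{\blacksquare m}=\mathcal Dend\,\blacksquare\cdots\blacksquare\,\mathcal Dend$ satisfies $$\dim\,(\mathcal Dend^{\blacksquare m})^!(n)\le n^m .$$ -/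

import Mathlib

/-!
Non-symmetric binary quadratic operads over a field `k`, presented by generators and relations.
A labelled planar binary tree is a `BinaryTree X`: inner vertices carry operations from `X`, and
`BinaryTree.nil` is a leaf (the identity operation, when it is the whole tree).
-/

/-- A presentation `𝒫(Ω, Λ)` of a binary quadratic non-symmetric operad with a finite number of
generating binary operations. `Ω` is the vector space with basis `Gen`, so `Ω ⊗ Ω` is
`Gen × Gen → k`, and `Λ = Rel` is a subspace of `(Ω ⊗ Ω) ⊕ (Ω ⊗ Ω)`. An element `(f, g)` of `Rel`
stands for the relation
`∑ f (a, b) • ((x a y) b z) = ∑ g (a, b) • (x a (y b z))`. -/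
structure QuadraticData (k : Type*) [Field k] where
  Gen : Type
  [fintypeGen : Fintype Gen]
  Rel : Submodule k ((Gen × Gen → k) × (Gen × Gen → k))

attribute [instance] QuadraticData.fintypeGen

noncomputable section

namespace FreeOperad

/-- `graft t i s` is the tree `t ∘ᵢ s` obtained by gluing the root of `s` to the leaf number `i`
of `t`. Leaves are numbered from left to right, starting with `0`; the value is meaningful only
for `i < t.numLeaves`. -/
def graft {X : Type} : BinaryTree X → ℕ → BinaryTree X → BinaryTree X
  | .nil, _, s => s
  | .node x l r, i, s =>
      if i < l.numLeaves then .node x (graft l i s) r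
      else .node x l (graft r (i - l.numLeaves) s)

/-- The arity `n` component of the free non-symmetric operad on the binary operations `X`: the
space spanned by the labelled planar binary trees with `n` leaves. -/
def component (k : Type*) [Field k] (X : Type) (n : ℕ) : Submodule k (BinaryTree X →₀ k) :=
  Finsupp.supported k k {t | t.numLeaves = n}

/-- The partial composition `u ∘ᵢ v`, the bilinear extension of grafting. -/
def comp {k : Type*} [Field k] {X : Type} (u : BinaryTree X →₀ k) (i : ℕ)
    (v : BinaryTree X →₀ k) : BinaryTree X →₀ k :=
  u.sum fun t a => v.sum fun s b => Finsupp.single (graft t i s) (a * b)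

/-- Operadic ideals of the free operad: families of subspaces of the components that are closed
under partial composition, on either side, with arbitrary elements of the free operad. -/
structure IsIdeal {k : Type*} [Field k] {X : Type}
    (I : ℕ → Submodule k (BinaryTree X →₀ k)) : Prop where
  le_component : ∀ n, I n ≤ component k X n
  comp_mem_left : ∀ p q i, i < p → ∀ u ∈ I p, ∀ v ∈ component k X q,
    comp u i v ∈ I (p + q - 1)
  comp_mem_right : ∀ p q i, i < p → ∀ u ∈ component k X p, ∀ v ∈ I q,
    comp u i v ∈ I (p + q - 1)

end FreeOperad

namespace QuadraticData

variable {k : Type*} [Field k]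

/-- The element of the free operad, of arity three, that a pair `(f, g)` sets to zero:
left-hand side minus right-hand side of the relation. -/
def relator {X : Type} [Fintype X] (w : (X × X → k) × (X × X → k)) : BinaryTree X →₀ k :=
  (∑ p : X × X, Finsupp.single (.node p.2 (.node p.1 .nil .nil) .nil) (w.1 p)) -
    ∑ p : X × X, Finsupp.single (.node p.1 .nil (.node p.2 .nil .nil)) (w.2 p)

/-- The operadic ideal generated by the relations, in arity `n`: the intersection of all operadic
ideals that contain the relations. -/
def ideal (P : QuadraticData k) (n : ℕ) : Submodule k (BinaryTree P.Gen →₀ k) :=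
  sInf {J | ∃ I : ℕ → Submodule k (BinaryTree P.Gen →₀ k),
    FreeOperad.IsIdeal I ∧ (∀ w ∈ P.Rel, relator w ∈ I 3) ∧ J = I n}

/-- The component `𝒫(n)` of the operad `𝒫(Ω, Λ)`: the arity `n` component of the free operad modulo
the arity `n` part of the ideal generated by the relations, realized as the image of the component
in the quotient of the space of all tree polynomials. -/
abbrev component (P : QuadraticData k) (n : ℕ) :
    Submodule k ((BinaryTree P.Gen →₀ k) ⧸ P.ideal n) :=
  (FreeOperad.component k P.Gen n).map (P.ideal n).mkQ

/-- The tensor product of `f ∈ Ω_P ⊗ Ω_P` and `g ∈ Ω_Q ⊗ Ω_Q` with the two middle factors switched,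
as an element of `(Ω_P ⊗ Ω_Q) ⊗ (Ω_P ⊗ Ω_Q)`. -/
def switch {X Y : Type} (f : X × X → k) (g : Y × Y → k) : (X × Y) × (X × Y) → k :=
  fun p => f (p.1.1, p.2.1) * g (p.1.2, p.2.2)

/-- The black square product: the operations are pairs of operations, the relations are spanned by
the pairs of relations. -/
def blackSquare (P Q : QuadraticData k) : QuadraticData k where
  Gen := P.Gen × Q.Gen
  Rel := Submodule.span k
    {w | ∃ u ∈ P.Rel, ∃ v ∈ Q.Rel, w = (switch u.1 v.1, switch u.2 v.2)}

/-- The operad of associative algebras, which is neutral for the black square product. -/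
def assoc (k : Type*) [Field k] : QuadraticData k where
  Gen := Unit
  Rel := Submodule.span k {(1, 1)}

/-- The `m`-fold black square product `P ■ ⋯ ■ P`. -/
def blackSquarePow (P : QuadraticData k) : ℕ → QuadraticData k
  | 0 => assoc k
  | 1 => P
  | m + 2 => blackSquare (blackSquarePow P (m + 1)) P

/-- The pairing between `(Ω ⊗ Ω) ⊕ (Ω ⊗ Ω)` and the same space for the dual `Ω^∨`, in terms of a
basis and its dual basis; the second summand carries a sign. -/
def pairing {X : Type} [Fintype X] (u v : (X × X → k) × (X × X → k)) : k :=
  ∑ p, u.1 p * v.1 p - ∑ p, u.2 p * v.2 p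

/-- The quadratic dual `𝒫(Ω^∨, Λ^⊥)`; the generators are the dual basis, indexed by the same
set. -/
def dual (P : QuadraticData k) : QuadraticData k where
  Gen := P.Gen
  Rel :=
    { carrier := {v | ∀ u ∈ P.Rel, pairing u v = 0}
      zero_mem' := by
        intro u _
        simp [pairing]
      add_mem' := by
        intro v w hv hw u hu
        have h1 := hv u hu
        have h2 := hw u hu
        simp only [pairing, Prod.fst_add, Prod.snd_add, Pi.add_apply, mul_add,
          Finset.sum_add_distrib] at h1 h2 ⊢
        linear_combination h1 + h2
      smul_mem' := by
        intro c v hv u hu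
        have h1 := hv u hu
        simp only [pairing, Prod.smul_fst, Prod.smul_snd, Pi.smul_apply, smul_eq_mul,
          mul_left_comm _ c, ← Finset.mul_sum] at h1 ⊢
        linear_combination c * h1 }

end QuadraticData

/-- The two dendriform operations `≺` and `≻`. -/
inductive DendOp : Type
  | prec
  | succ
  deriving DecidableEq

instance : Fintype DendOp where
  elems := {DendOp.prec, DendOp.succ}
  complete := by
    intro x
    cases x <;> simp

open DendOp in
/-- The dendriform operad: with `* = ≺ + ≻`, the relations are
`(x ≺ y) ≺ z = x ≺ (y * z)`, `(x ≻ y) ≺ z = x ≻ (y ≺ z)` and `(x * y) ≻ z = x ≻ (y ≻ z)`. -/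
def Dend (k : Type*) [Field k] : QuadraticData k where
  Gen := DendOp
  Rel := Submodule.span k
    {(Pi.single (prec, prec) 1, Pi.single (prec, prec) 1 + Pi.single (prec, succ) 1),
     (Pi.single (succ, prec) 1, Pi.single (succ, prec) 1),
     (Pi.single (prec, succ) 1 + Pi.single (succ, succ) 1, Pi.single (succ, succ) 1)}

end

/-!
A planar binary tree labelled by `≺` and `≻` marks one of its leaves: walk from the root to the
left at a vertex `≺` and to the right at a vertex `≻`. Both sides of a dendriform relation carry
the same coefficient at any two monomials that mark the same leaf, so in the dual operad these
monomials of arity three become equal (this is the diassociative operad). For an `m`-fold black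
square product the labels are `m`-tuples of operations, and a tree marks one leaf for every
coordinate. Rotating trees to the right shows that a monomial of arity `n` depends only on its `m`
marked leaves in the dual operad, which leaves at most `n ^ m` monomials.
-/

namespace FreeOperad

variable {k : Type*} [Field k] {X : Type}

theorem eq_nil_of_numLeaves_eq_one {t : BinaryTree X} (h : t.numLeaves = 1) : t = .nil := by
  cases t with
  | nil => rfl
  | node x l r =>
    have hl := l.numLeaves_pos
    have hr := r.numLeaves_pos
    simp only [BinaryTree.numLeaves] at h
    omega

theorem numLeaves_graft (t s : BinaryTree X) (i : ℕ) :
    (graft t i s).numLeaves = t.numLeaves + s.numLeaves - 1 := by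
  induction t generalizing i with
  | nil => simp only [graft, BinaryTree.numLeaves, add_tsub_cancel_left]
  | node x l r hl hr =>
    have hl_pos := l.numLeaves_pos
    have hr_pos := r.numLeaves_pos
    simp only [graft]
    split_ifs <;> simp only [BinaryTree.numLeaves, hl, hr] <;> omega

theorem single_mem_component (t : BinaryTree X) :
    Finsupp.single t (1 : k) ∈ component k X t.numLeaves :=
  Finsupp.single_mem_supported k 1 rfl

theorem comp_mem_component {p q : ℕ} {u v : BinaryTree X →₀ k} (hu : u ∈ component k X p) (i : ℕ)
    (hv : v ∈ component k X q) : comp u i v ∈ component k X (p + q - 1) := by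
  refine sum_mem fun t ht => sum_mem fun s hs => Finsupp.single_mem_supported k _ ?_
  have ht_leaves : t.numLeaves = p := hu ht
  have hs_leaves : s.numLeaves = q := hv hs
  rw [Set.mem_ofPred_eq, numLeaves_graft, ht_leaves, hs_leaves]

theorem isIdeal_component : IsIdeal (component k X) where
  le_component _ := le_rfl
  comp_mem_left _ _ i _ _ hu _ hv := comp_mem_component hu i hv
  comp_mem_right _ _ i _ _ hu _ hv := comp_mem_component hu i hv

theorem comp_single_sub (t a b : BinaryTree X) (i : ℕ) :
    comp (Finsupp.single t (1 : k)) i (Finsupp.single a 1 - Finsupp.single b 1) =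
      Finsupp.single (graft t i a) 1 - Finsupp.single (graft t i b) 1 := by
  rw [comp, Finsupp.sum_single_index (by simp), Finsupp.sum_sub_index (by simp)]
  simp

theorem comp_sub_single (t a b : BinaryTree X) (i : ℕ) :
    comp (Finsupp.single a (1 : k) - Finsupp.single b 1) i (Finsupp.single t 1) =
      Finsupp.single (graft a i t) 1 - Finsupp.single (graft b i t) 1 := by
  rw [comp, Finsupp.sum_sub_index (by simp [sub_mul])]
  simp only [zero_mul, mul_zero, one_mul, Finsupp.single_zero, Finsupp.sum_single_index]

/-- Congruence of trees of the same arity modulo the family of subspaces `I`. -/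
def TreeCongr (I : ℕ → Submodule k (BinaryTree X →₀ k)) (t s : BinaryTree X) : Prop :=
  t.numLeaves = s.numLeaves ∧ Finsupp.single t 1 - Finsupp.single s 1 ∈ I t.numLeaves

variable {I : ℕ → Submodule k (BinaryTree X →₀ k)}

namespace TreeCongr

variable {t s r : BinaryTree X}

theorem refl (t : BinaryTree X) : TreeCongr I t t := ⟨rfl, by simp⟩

theorem symm (h : TreeCongr I t s) : TreeCongr I s t :=
  ⟨h.1.symm, by rw [← h.1, ← neg_sub]; exact neg_mem h.2⟩

theorem trans (h : TreeCongr I t s) (h' : TreeCongr I s r) : TreeCongr I t r :=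
  ⟨h.1.trans h'.1, by
    rw [← sub_add_sub_cancel]
    exact add_mem h.2 (h.1 ▸ h'.2)⟩

instance : Trans (TreeCongr I) (TreeCongr I) (TreeCongr I) := ⟨trans⟩

end TreeCongr

/-- The monomial `(x a y) b z`. -/
def leftComb (a b : X) : BinaryTree X := .node b (.node a .nil .nil) .nil

/-- The monomial `x a (y b z)`. -/
def rightComb (a b : X) : BinaryTree X := .node a .nil (.node b .nil .nil)

namespace IsIdeal

variable (hI : IsIdeal I) {t s : BinaryTree X}
include hI

theorem congr_graft_right (h : TreeCongr I t s) (r : BinaryTree X) {i : ℕ}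
    (hi : i < r.numLeaves) : TreeCongr I (graft r i t) (graft r i s) := by
  refine ⟨by simp only [numLeaves_graft, h.1], ?_⟩
  rw [← comp_single_sub, numLeaves_graft]
  exact hI.comp_mem_right _ _ _ hi _ (single_mem_component r) _ h.2

theorem congr_graft_left (h : TreeCongr I t s) (r : BinaryTree X) {i : ℕ}
    (hi : i < t.numLeaves) : TreeCongr I (graft t i r) (graft s i r) := by
  refine ⟨by simp only [numLeaves_graft, h.1], ?_⟩
  rw [← comp_sub_single, numLeaves_graft]
  exact hI.comp_mem_left _ _ _ hi _ h.2 _ (single_mem_component r)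

theorem congr_node_right (x : X) (l : BinaryTree X) (h : TreeCongr I t s) :
    TreeCongr I (.node x l t) (.node x l s) := by
  simpa [graft, BinaryTree.numLeaves] using
    hI.congr_graft_right h (.node x l .nil) (i := l.numLeaves) (by simp [BinaryTree.numLeaves])

theorem congr_rotate {a b c d : X} (h : TreeCongr I (leftComb a b) (rightComb c d))
    (t s r : BinaryTree X) :
    TreeCongr I (.node b (.node a t s) r) (.node c t (.node d s r)) := by
  -- Substituting from right to left keeps the numbers of the remaining leaves.
  have hr := hI.congr_graft_left h r (i := 2) (by simp [leftComb, BinaryTree.numLeaves])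
  simp only [leftComb, rightComb, graft, BinaryTree.numLeaves, Nat.reduceAdd, Nat.reduceLT,
    Nat.reduceSub, if_false] at hr
  have hs := hI.congr_graft_left hr s (i := 1) (by simp [BinaryTree.numLeaves]; omega)
  simp only [graft, BinaryTree.numLeaves, Nat.reduceAdd, Nat.reduceLT, Nat.reduceSub, if_true,
    if_false] at hs
  have ht := hI.congr_graft_left hs t (i := 0) (by simp [BinaryTree.numLeaves])
  simpa [graft, BinaryTree.numLeaves] using ht

end IsIdeal

open DendOp

/-- The leaf that a tree marks when `f` reads its labels as dendriform operations: from the root,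
go left at `≺` and right at `≻`. Leaves are numbered from left to right, starting with `0`. -/
def markedLeaf (f : X → DendOp) : BinaryTree X → ℕ
  | .nil => 0
  | .node x l r => if f x = prec then markedLeaf f l else l.numLeaves + markedLeaf f r

theorem markedLeaf_lt (f : X → DendOp) (t : BinaryTree X) : markedLeaf f t < t.numLeaves := by
  induction t with
  | nil => exact Nat.one_pos
  | node x l r hl hr =>
    simp only [markedLeaf, BinaryTree.numLeaves]
    split_ifs <;> omega

theorem markedLeaf_leftComb (f : X → DendOp) (a b : X) :
    markedLeaf f (leftComb a b) =
      if f b = prec then if f a = prec then 0 else 1 else 2 := by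
  simp only [leftComb, markedLeaf, BinaryTree.numLeaves, Nat.reduceAdd, add_zero]

theorem markedLeaf_rightComb (f : X → DendOp) (a b : X) :
    markedLeaf f (rightComb a b) =
      if f a = prec then 0 else if f b = prec then 1 else 2 := by
  simp only [rightComb, markedLeaf, BinaryTree.numLeaves, add_zero]
  split_ifs <;> rfl

theorem markedLeaf_rotate {f : X → DendOp} {a b c d : X}
    (h : markedLeaf f (leftComb a b) = markedLeaf f (rightComb c d)) (t s r : BinaryTree X) :
    markedLeaf f (.node b (.node a t s) r) = markedLeaf f (.node c t (.node d s r)) := by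
  simp only [markedLeaf_leftComb, markedLeaf_rightComb, markedLeaf, BinaryTree.numLeaves] at h ⊢
  split_ifs at h ⊢ <;> omega

theorem markedLeaf_node_nil_eq_iff {f : X → DendOp} {x y : X} {t s : BinaryTree X} :
    markedLeaf f (.node x .nil t) = markedLeaf f (.node y .nil s) ↔
      f x = f y ∧ (f x ≠ prec → markedLeaf f t = markedLeaf f s) := by
  cases hx : f x <;> cases hy : f y <;>
    simp [markedLeaf, BinaryTree.numLeaves, hx, hy]
  omega

/-- An operadic ideal modulo which two monomials `(x a y) b z` and `x c (y d z)` are congruent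
whenever they mark the same leaf in every coordinate. For a single coordinate these are the
relations of the diassociative operad, the quadratic dual of the dendriform operad. -/
structure IsDiasIdeal {ι : Type*} (e : X ≃ (ι → DendOp))
    (I : ℕ → Submodule k (BinaryTree X →₀ k)) : Prop where
  isIdeal : IsIdeal I
  congr_comb : ∀ a b c d : X,
    (∀ i, markedLeaf (e · i) (leftComb a b) = markedLeaf (e · i) (rightComb c d)) →
      TreeCongr I (leftComb a b) (rightComb c d)

namespace IsDiasIdeal

variable {ι : Type*} {e : X ≃ (ι → DendOp)} (hI : IsDiasIdeal e I)
include hI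

theorem exists_congr_node_nil (x : X) (l r : BinaryTree X) :
    ∃ y s, TreeCongr I (.node x l r) (.node y .nil s) ∧
      ∀ i, markedLeaf (e · i) (.node x l r) = markedLeaf (e · i) (.node y .nil s) := by
  induction l generalizing x r with
  | nil => exact ⟨x, r, .refl _, fun _ => rfl⟩
  | node a l₁ l₂ ih =>
    let c := e.symm fun i => if e x i = prec then e a i else succ
    have hmark (i) : markedLeaf (e · i) (leftComb a x) = markedLeaf (e · i) (rightComb c x) := by
      cases hx : e x i <;> cases ha : e a i <;>
        simp [c, markedLeaf_leftComb, markedLeaf_rightComb, hx, ha]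
    obtain ⟨y, s, hcongr, hleaf⟩ := ih c (.node x l₂ r)
    exact ⟨y, s, (hI.isIdeal.congr_rotate (hI.congr_comb _ _ _ _ hmark) _ _ _).trans hcongr,
      fun i => (markedLeaf_rotate (hmark i) _ _ _).trans (hleaf i)⟩

theorem congr_inner_node {x y w : X} (hw : ∀ i, e w i = if e x i = prec then prec else e y i)
    (t s r : BinaryTree X) :
    TreeCongr I (.node x t (.node y s r)) (.node x t (.node w s r)) := by
  -- Both sides are congruent to `.node w (.node x t s) r`.
  have hxy := hI.congr_comb x w x y fun i => by
    cases hx : e x i <;> simp [markedLeaf_leftComb, markedLeaf_rightComb, hw, hx]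
  have hxw := hI.congr_comb x w x w fun i => by
    cases hx : e x i <;> simp [markedLeaf_leftComb, markedLeaf_rightComb, hw, hx]
  exact (hI.isIdeal.congr_rotate hxy t s r).symm.trans (hI.isIdeal.congr_rotate hxw t s r)

theorem eq_or_exists_congr_node_nil {t s : BinaryTree X} (hn : t.numLeaves = s.numLeaves) :
    t = s ∨ ∃ x t' y s', TreeCongr I t (.node x .nil t') ∧ TreeCongr I s (.node y .nil s') ∧
      t'.numLeaves = s'.numLeaves ∧ t'.numLeaves < t.numLeaves ∧
      ∀ i, markedLeaf (e · i) t = markedLeaf (e · i) s →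
        e x i = e y i ∧ (e x i ≠ prec → markedLeaf (e · i) t' = markedLeaf (e · i) s') := by
  match t, s with
  | .nil, s => exact .inl (eq_nil_of_numLeaves_eq_one hn.symm).symm
  | t, .nil => exact .inl (eq_nil_of_numLeaves_eq_one hn)
  | .node a l r, .node b l' r' =>
    obtain ⟨x, t', ht, ht_leaf⟩ := hI.exists_congr_node_nil a l r
    obtain ⟨y, s', hs, hs_leaf⟩ := hI.exists_congr_node_nil b l' r'
    refine .inr ⟨x, t', y, s', ht, hs, add_left_cancel (ht.1.symm.trans (hn.trans hs.1)),
      ht.1.symm ▸ lt_add_of_pos_left _ Nat.one_pos, fun i hi => ?_⟩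
    rw [ht_leaf, hs_leaf] at hi
    exact markedLeaf_node_nil_eq_iff.1 hi

theorem congr_node_nil {x : X} {t s : BinaryTree X} (hn : t.numLeaves = s.numLeaves)
    (hleaf : ∀ i, e x i ≠ prec → markedLeaf (e · i) t = markedLeaf (e · i) s) :
    TreeCongr I (.node x .nil t) (.node x .nil s) := by
  induction hN : t.numLeaves using Nat.strong_induction_on generalizing x t s with | _ N ih
  obtain rfl | ⟨y, t', z, s', ht, hs, hn', hlt, hleaf'⟩ := hI.eq_or_exists_congr_node_nil hn
  · exact .refl _
  -- Below `x`, the roots of both right factors can be relabelled by the same `w`, which is `≻` only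
  -- where `x` is.
  let w := e.symm fun i => if e x i = prec then prec else e y i
  have hwy (i) : e w i = if e x i = prec then prec else e y i := by
    simp only [w, Equiv.apply_symm_apply]
  have hwz (i) : e w i = if e x i = prec then prec else e z i := by
    rw [hwy]
    split_ifs with hx
    exacts [rfl, (hleaf' i (hleaf i hx)).1]
  have hts : TreeCongr I (.node w .nil t') (.node w .nil s') := by
    refine ih _ (hN ▸ hlt) hn' (fun i hi => ?_) rfl
    rw [hwy, ite_ne_left_iff] at hi
    exact (hleaf' i (hleaf i hi.1)).2 hi.2.symm
  calc
    TreeCongr I (.node x .nil t) (.node x .nil (.node y .nil t')) :=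
      hI.isIdeal.congr_node_right x .nil ht
    TreeCongr I _ (.node x .nil (.node w .nil t')) := hI.congr_inner_node hwy .nil .nil t'
    TreeCongr I _ (.node x .nil (.node w .nil s')) := hI.isIdeal.congr_node_right x .nil hts
    TreeCongr I _ (.node x .nil (.node z .nil s')) := (hI.congr_inner_node hwz .nil .nil s').symm
    TreeCongr I _ (.node x .nil s) := (hI.isIdeal.congr_node_right x .nil hs).symm

theorem congr_of_markedLeaf_eq {t s : BinaryTree X} (hn : t.numLeaves = s.numLeaves)
    (hleaf : ∀ i, markedLeaf (e · i) t = markedLeaf (e · i) s) : TreeCongr I t s := by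
  obtain rfl | ⟨x, t', y, s', ht, hs, hn', -, hleaf'⟩ := hI.eq_or_exists_congr_node_nil hn
  · exact .refl _
  obtain rfl : x = y := e.injective (funext fun i => (hleaf' i (hleaf i)).1)
  exact ht.trans ((hI.congr_node_nil hn' fun i => (hleaf' i (hleaf i)).2).trans hs.symm)

end IsDiasIdeal

end FreeOperad

namespace QuadraticData

open DendOp FreeOperad

variable {k : Type*} [Field k]

theorem relator_mem_component {X : Type} [Fintype X] (w : (X × X → k) × (X × X → k)) :
    relator w ∈ FreeOperad.component k X 3 :=
  sub_mem (sum_mem fun _ _ => Finsupp.single_mem_supported k _ rfl)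
    (sum_mem fun _ _ => Finsupp.single_mem_supported k _ rfl)

open Classical in
theorem relator_single {X : Type} [Fintype X] (a b c d : X) :
    relator (Pi.single (a, b) (1 : k), Pi.single (c, d) 1) =
      Finsupp.single (leftComb a b) 1 - Finsupp.single (rightComb c d) 1 := by
  rw [relator, Finset.sum_eq_single (a, b), Finset.sum_eq_single (c, d)]
  · simp only [Pi.single_eq_same, leftComb, rightComb]
  all_goals simp +contextual

theorem mem_ideal_iff {P : QuadraticData k} {n : ℕ} {u : BinaryTree P.Gen →₀ k} :
    u ∈ P.ideal n ↔ ∀ I : ℕ → Submodule k (BinaryTree P.Gen →₀ k),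
      IsIdeal I → (∀ w ∈ P.Rel, relator w ∈ I 3) → u ∈ I n := by
  simp only [ideal, Submodule.mem_sInf]
  exact ⟨fun h I hI hrel => h _ ⟨I, hI, hrel, rfl⟩, fun h _ ⟨I, hI, hrel, hJ⟩ => hJ ▸ h I hI hrel⟩

theorem isIdeal_ideal (P : QuadraticData k) : IsIdeal P.ideal where
  le_component _ _ hu := mem_ideal_iff.1 hu _ isIdeal_component fun w _ => relator_mem_component w
  comp_mem_left p q i hi u hu v hv := mem_ideal_iff.2 fun I hI hrel =>
    hI.comp_mem_left p q i hi u (mem_ideal_iff.1 hu I hI hrel) v hv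
  comp_mem_right p q i hi u hu v hv := mem_ideal_iff.2 fun I hI hrel =>
    hI.comp_mem_right p q i hi u hu v (mem_ideal_iff.1 hv I hI hrel)

theorem relator_mem_ideal {P : QuadraticData k} {w : (P.Gen × P.Gen → k) × (P.Gen × P.Gen → k)}
    (hw : w ∈ P.Rel) : relator w ∈ P.ideal 3 :=
  mem_ideal_iff.2 fun _ _ hrel => hrel w hw

open Classical in
theorem treeCongr_of_single_mem_rel {P : QuadraticData k} {a b c d : P.Gen}
    (h : (Pi.single (a, b) 1, Pi.single (c, d) 1) ∈ P.Rel) :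
    TreeCongr P.ideal (leftComb a b) (rightComb c d) :=
  ⟨rfl, relator_single (k := k) a b c d ▸ relator_mem_ideal h⟩

theorem component_eq_span_range (P : QuadraticData k) (n : ℕ) :
    P.component n = Submodule.span k (Set.range fun t : {t : BinaryTree P.Gen // t.numLeaves = n} =>
      (P.ideal n).mkQ (Finsupp.single t.1 1)) := by
  rw [component, FreeOperad.component, Finsupp.supported_eq_span_single, Submodule.map_span,
    ← Set.image_comp, Set.image_eq_range]
  rfl

theorem rank_component_le_card (P : QuadraticData k) {n : ℕ} {κ : Type} [Fintype κ]
    (f : {t : BinaryTree P.Gen // t.numLeaves = n} → κ)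
    (hf : ∀ t s, f t = f s → TreeCongr P.ideal t.1 s.1) :
    Module.rank k (P.component n) ≤ Fintype.card κ := by
  let b (t : {t : BinaryTree P.Gen // t.numLeaves = n}) : (BinaryTree P.Gen →₀ k) ⧸ P.ideal n :=
    (P.ideal n).mkQ (Finsupp.single t.1 1)
  have hb : b.FactorsThrough f := fun t s hts =>
    (Submodule.Quotient.eq _).2 (by simpa only [t.2] using (hf t s hts).2)
  have hrange : Set.range b ⊆ Set.range (f.extend b 0) := by
    rintro _ ⟨t, rfl⟩
    exact ⟨f t, hb.extend_apply 0 t⟩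
  calc Module.rank k (P.component n)
      ≤ Cardinal.mk (Set.range b) := P.component_eq_span_range n ▸ rank_span_le _
    _ ≤ Cardinal.mk (Set.range (f.extend b 0)) := Cardinal.mk_le_mk_of_subset hrange
    _ ≤ Fintype.card κ := by
      simpa only [Cardinal.lift_uzero, Cardinal.mk_fintype, Cardinal.lift_natCast] using
        Cardinal.mk_range_le_lift (f := f.extend b 0)

theorem rank_component_le_pow (P : QuadraticData k) {ι : Type} [Fintype ι]
    {e : P.Gen ≃ (ι → DendOp)} (hP : IsDiasIdeal e P.ideal) (n : ℕ) :
    Module.rank k (P.component n) ≤ ((n ^ Fintype.card ι : ℕ) : Cardinal) := by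
  classical
  have hrank := P.rank_component_le_card (n := n) (κ := ι → Fin n)
    (fun t i => ⟨markedLeaf (e · i) t.1, (markedLeaf_lt _ _).trans_eq t.2⟩)
    fun t s hts => hP.congr_of_markedLeaf_eq (t.2.trans s.2.symm) fun i =>
      congrArg Fin.val (congrFun hts i)
  simpa only [Fintype.card_fun, Fintype.card_fin] using hrank

/-- The generators of `P` are tuples of dendriform operations, and the two sides of every relation
have the same coefficient at monomials that mark the same leaf in every coordinate. -/
def IsDendLike (P : QuadraticData k) {ι : Type*} (e : P.Gen ≃ (ι → DendOp)) : Prop :=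
  ∀ u ∈ P.Rel, ∀ a b c d,
    (∀ i, markedLeaf (e · i) (leftComb a b) = markedLeaf (e · i) (rightComb c d)) →
      u.1 (a, b) = u.2 (c, d)

theorem isDendLike_of_rel_eq_span {P : QuadraticData k} {ι : Type*} {e : P.Gen ≃ (ι → DendOp)}
    {S : Set ((P.Gen × P.Gen → k) × (P.Gen × P.Gen → k))} (hS : P.Rel = Submodule.span k S)
    (h : ∀ u ∈ S, ∀ a b c d,
      (∀ i, markedLeaf (e · i) (leftComb a b) = markedLeaf (e · i) (rightComb c d)) →
        u.1 (a, b) = u.2 (c, d)) : P.IsDendLike e := by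
  intro u hu a b c d hmark
  rw [hS] at hu
  induction hu using Submodule.span_induction with
  | mem u hu => exact h u hu a b c d hmark
  | zero => rfl
  | add u v _ _ hu hv => exact congrArg₂ (· + ·) hu hv
  | smul r u _ hu => exact congrArg (r * ·) hu

theorem isDendLike_assoc :
    (assoc k).IsDendLike (Equiv.ofUnique Unit (Empty → DendOp)) :=
  isDendLike_of_rel_eq_span rfl fun _ hu _ _ _ _ _ => by
    rw [Set.mem_singleton_iff.1 hu]
    rfl

theorem isDendLike_dend : (Dend k).IsDendLike (Equiv.funUnique Unit DendOp).symm := by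
  refine isDendLike_of_rel_eq_span rfl fun u hu (a b c d : DendOp) hmark => ?_
  replace hmark : markedLeaf id (leftComb a b) = markedLeaf id (rightComb c d) := hmark ()
  rcases hu with rfl | rfl | rfl <;> cases a <;> cases b <;> cases c <;> cases d <;>
    simp [markedLeaf_leftComb, markedLeaf_rightComb, Dend] at hmark ⊢

theorem IsDendLike.blackSquare {P Q : QuadraticData k} {ι κ : Type*} {e : P.Gen ≃ (ι → DendOp)}
    {e' : Q.Gen ≃ (κ → DendOp)} (hP : P.IsDendLike e) (hQ : Q.IsDendLike e') :
    (P.blackSquare Q).IsDendLike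
      ((e.prodCongr e').trans (Equiv.sumArrowEquivProdArrow ι κ DendOp).symm) := by
  refine isDendLike_of_rel_eq_span rfl ?_
  rintro _ ⟨u, hu, v, hv, rfl⟩ ⟨a, a'⟩ ⟨b, b'⟩ ⟨c, c'⟩ ⟨d, d'⟩ hmark
  exact congrArg₂ (· * ·) (hP u hu a b c d fun i => hmark (.inl i))
    (hQ v hv a' b' c' d' fun i => hmark (.inr i))

theorem exists_isDendLike_blackSquarePow_dend :
    ∀ m : ℕ, ∃ (ι : Type) (_ : Fintype ι) (e : ((Dend k).blackSquarePow m).Gen ≃ (ι → DendOp)),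
      Fintype.card ι = m ∧ ((Dend k).blackSquarePow m).IsDendLike e
  | 0 => ⟨Empty, inferInstance, _, rfl, isDendLike_assoc⟩
  | 1 => ⟨Unit, inferInstance, _, rfl, isDendLike_dend⟩
  | m + 2 =>
    let ⟨ι, _, _, hcard, he⟩ := exists_isDendLike_blackSquarePow_dend (m + 1)
    ⟨ι ⊕ Unit, inferInstance, _, by rw [Fintype.card_sum, hcard, Fintype.card_unit],
      he.blackSquare isDendLike_dend⟩

namespace IsDendLike

variable {P : QuadraticData k} {ι : Type*} {e : P.Gen ≃ (ι → DendOp)} (hP : P.IsDendLike e)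
include hP

open Classical in
theorem single_mem_dual_rel {a b c d : P.Gen}
    (hmark : ∀ i, markedLeaf (e · i) (leftComb a b) = markedLeaf (e · i) (rightComb c d)) :
    (Pi.single (a, b) 1, Pi.single (c, d) 1) ∈ P.dual.Rel := by
  intro u hu
  simp [pairing, Pi.single_apply, hP u hu a b c d hmark]

theorem isDiasIdeal_dual : IsDiasIdeal (X := P.dual.Gen) e P.dual.ideal where
  isIdeal := P.dual.isIdeal_ideal
  congr_comb _ _ _ _ hmark :=
    treeCongr_of_single_mem_rel (P := P.dual) (hP.single_mem_dual_rel hmark)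

end IsDendLike

end QuadraticData

theorem lemma5p3_general (k : Type*) [Field k] (m n : ℕ) :
    Module.rank k ((QuadraticData.blackSquarePow (Dend k) m).dual.component n) ≤
      ((n ^ m : ℕ) : Cardinal) := by
  obtain ⟨ι, _, e, rfl, he⟩ := QuadraticData.exists_isDendLike_blackSquarePow_dend (k := k) m
  exact QuadraticData.rank_component_le_pow _ he.isDiasIdeal_dual n

theorem lemma5p3 (k : Type*) [Field k] [IsAlgClosed k] [CharZero k] (m : ℕ) (hm : 1 ≤ m) (n : ℕ) :
    Module.rank k ((QuadraticData.blackSquarePow (Dend k) m).dual.component n) ≤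
      ((n ^ m : ℕ) : Cardinal) :=
  lemma5p3_general k m n
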